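/- Let $\mathbb{D}_r=\{z\in\mathbb{C}:|z|<r\}$ and $\mathbb{D}=\mathbb{D}_1$. Let $\psi$ be analytic and univalent in $\mathbb{D}$ with $\psi(0)=1$ and $\operatorname{Re}\psi>0$, and let $\mathcal{S}^*(\psi)$ be the class of analytic functions $h$ in $\mathbb{D}$ with $h(0)=0$, $h'(0)=1$ and $zh'(z)/h(z)\prec\psi(z)$ (that is, $zh'(z)/h(z)=\psi(\omega(z))$ in $\mathbb{D}$ for some analytic $\omega:\mathbb{D}\to\mathbb{D}$ with $\omega(0)=0$). Put $m(r)=\min_{|z|=r}|\psi(z)|$ for $0<r<1$, and let $r_c$ be the radius of convexity of $\mathcal{S}^*(\psi)$, i.e. the largest $r\le 1$ such that every $h\in\mathcal{S}^*(\psi)$ maps $\mathbb{D}_r$ univalently onto a convex domain. Then the equation $$(1-r^2)\,m(r)-2r=0$$ has a unique root $r_\psi$ in $(0,1)$. Put $R=\min\{r_\psi,r_c\}$, and consider the harmonic mappings $f=h+\bar g$ of $\mathbb{D}$ with $h\in\mathcal{S}^*(\psi)$ and $g=\varphi h$, where $\varphi:\mathbb{D}\to\mathbb{D}$ is analytic (so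 $|\varphi|<1$). (a) Every such $f$ is sense-preserving (its Jacobian $J_f=|f_z|^2-|f_{\bar z}|^2$ is positive) and univalent in $\mathbb{D}_R$. (b) If $r_c\ge r_\psi$ and $m(r)=\psi(-r)$ for all $0<r<1$, the result is sharp: for every $\rho$ with $R<\rho\le 1$ there is such an $f$ which is neither sense-preserving nor univalent in $\mathbb{D}_\rho$. -/

import Mathlib

open Set Metric

noncomputable section

/-- The open disk `|z| < r`; the unit disk is `disk 1`. -/
abbrev disk (r : ℝ) : Set ℂ := ball (0 : ℂ) r

/-- A Ma-Minda function: analytic and univalent in the unit disk, with `ψ 0 = 1` and positive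
real part. -/
structure IsMaMinda (ψ : ℂ → ℂ) : Prop where
  analytic : DifferentiableOn ℂ ψ (disk 1)
  univalent : InjOn ψ (disk 1)
  map_zero : ψ 0 = 1
  re_pos : ∀ z ∈ disk 1, 0 < (ψ z).re

/-- The class of analytic self-maps of the open unit disk. -/
structure IsSelfMap (φ : ℂ → ℂ) : Prop where
  analytic : DifferentiableOn ℂ φ (disk 1)
  mapsTo : MapsTo φ (disk 1) (disk 1)

/-- Subordination `F ≺ G` in the unit disk: `F = G ∘ ω` for an analytic self-map `ω` of the unit
disk fixing the origin. -/
def Subordinate (F G : ℂ → ℂ) : Prop :=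
  ∃ ω : ℂ → ℂ, IsSelfMap ω ∧ ω 0 = 0 ∧ ∀ z ∈ disk 1, F z = G (ω z)

/-- The function `z h'(z) / h(z)`, with its removable singularity at the origin filled in
(for `h 0 = 0` and `h' 0 = 1` the limit there is `1`). -/
def starQuotient (h : ℂ → ℂ) (z : ℂ) : ℂ :=
  if z = 0 then 1 else z * deriv h z / h z

/-- The Ma-Minda class `S*(ψ)`: normalized analytic `h` in the unit disk with
`z h' / h ≺ ψ`. -/
structure MaMindaStarlike (ψ h : ℂ → ℂ) : Prop where
  analytic : DifferentiableOn ℂ h (disk 1)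
  map_zero : h 0 = 0
  deriv_zero : deriv h 0 = 1
  ne_zero : ∀ z ∈ disk 1, z ≠ 0 → h z ≠ 0
  subordinate : Subordinate (starQuotient h) ψ

/-- `m(r)`, the minimum of `|ψ z|` over the circle `|z| = r`
(an attained minimum, see `isLeast_minModulus`). -/
def minModulus (ψ : ℂ → ℂ) (r : ℝ) : ℝ :=
  sInf ((fun z => ‖ψ z‖) '' sphere (0 : ℂ) r)

theorem isLeast_minModulus {ψ : ℂ → ℂ} (hψ : IsMaMinda ψ) {r : ℝ} (h0 : 0 ≤ r) (h1 : r < 1) :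
    IsLeast ((fun z => ‖ψ z‖) '' sphere (0 : ℂ) r) (minModulus ψ r) := by
  have hc : ContinuousOn (fun z => ‖ψ z‖) (sphere (0 : ℂ) r) :=
    (hψ.analytic.continuousOn.mono
      (sphere_subset_closedBall.trans (closedBall_subset_ball h1))).norm
  exact ((isCompact_sphere (0 : ℂ) r).image_of_continuousOn hc).isLeast_sInf
    ((NormedSpace.sphere_nonempty.mpr h0).image _)

/-- `h` maps `U` one-to-one onto a convex set. -/
def ConvexUnivalentOn (h : ℂ → ℂ) (U : Set ℂ) : Prop :=
  InjOn h U ∧ Convex ℝ (h '' U)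

/-- The radius of convexity of `S*(ψ)`: the largest `r ≤ 1` such that every `h` in the class is
convex univalent in `|z| < r`. -/
def radiusOfConvexity (ψ : ℂ → ℂ) : ℝ :=
  sSup {r : ℝ | 0 < r ∧ r ≤ 1 ∧ ∀ h, MaMindaStarlike ψ h → ConvexUnivalentOn h (disk r)}

/-- The Wirtinger derivative `f_z = (f_x - i f_y) / 2`. -/
def wirtinger (f : ℂ → ℂ) (z : ℂ) : ℂ :=
  (fderiv ℝ f z 1 - Complex.I * fderiv ℝ f z Complex.I) / 2

/-- The Wirtinger derivative of `f` in the conjugate variable, `(f_x + i f_y) / 2`. -/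
def wirtingerBar (f : ℂ → ℂ) (z : ℂ) : ℂ :=
  (fderiv ℝ f z 1 + Complex.I * fderiv ℝ f z Complex.I) / 2

/-- The Jacobian of `f` as a map of the plane. -/
def jacobian (f : ℂ → ℂ) (z : ℂ) : ℝ :=
  ‖wirtinger f z‖ ^ 2 - ‖wirtingerBar f z‖ ^ 2

/-- A harmonic mapping is sense-preserving in `U` when its Jacobian is positive there. -/
def SensePreservingOn (f : ℂ → ℂ) (U : Set ℂ) : Prop :=
  ∀ z ∈ U, 0 < jacobian f z

/-- The harmonic mappings `f = h + conj g` of the unit disk with `h` in `S*(ψ)` and `g = φ h`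
for an analytic self-map `φ` of the unit disk. -/
def HarmonicClass (ψ f : ℂ → ℂ) : Prop :=
  ∃ h g φ : ℂ → ℂ, MaMindaStarlike ψ h ∧ IsSelfMap φ ∧
    (∀ z ∈ disk 1, g z = φ z * h z) ∧
    ∀ z ∈ disk 1, f z = h z + (starRingEnd ℂ) (g z)

/-- `r` is a root in `(0, 1)` of `(1 - r²) m(r) - 2 r = 0`. -/
def IsRadiusRoot (ψ : ℂ → ℂ) (r : ℝ) : Prop :=
  0 < r ∧ r < 1 ∧ (1 - r ^ 2) * minModulus ψ r - 2 * r = 0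

end

/-!
Write `g = φ h` and `|z| = r`. The minimum principle gives `m(r) |h| ≤ r |h'|`, and Schwarz-Pick
bounds `|φ'|`, so `(1 - r²) m(r) ≥ 2 r` forces
`|g'| ≤ (|φ| + (1 - |φ|²) / 2) |h'| < |h'|`, which is positivity of the Jacobian. Below the radius
of convexity the image of `h` is convex, so `g ∘ h⁻¹`, whose derivative has modulus less than `1`,
strictly decreases distances there, and hence `h + conj g` is injective.

For sharpness take `h` with `z h' / h = ψ` and `φ = (z + a) / (1 + a z)` for real `a` close to `-1`.
On `(-1, 0]` the map `f` is then real-valued with `f < 0 = f 0` off the origin, but `f'` is negative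
at a point just beyond `-r_ψ`.
-/

section MeanValue

variable {E : Type*} [NormedAddCommGroup E] [NormedSpace ℂ E] [CompleteSpace E]

theorem norm_image_sub_lt_of_norm_deriv_lt {f : ℂ → E} {U : Set ℂ} {x y : ℂ} {C : ℝ}
    (hU : IsOpen U) (hf : DifferentiableOn ℂ f U) (hseg : segment ℝ x y ⊆ U)
    (hC : ∀ z ∈ segment ℝ x y, ‖deriv f z‖ < C) (hxy : x ≠ y) :
    ‖f y - f x‖ < C * ‖y - x‖ := by
  have hcompact : IsCompact (segment ℝ x y) := by
    rw [segment_eq_image_lineMap]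
    exact isCompact_Icc.image (by fun_prop)
  obtain ⟨z, hz, hmax⟩ := hcompact.exists_isMaxOn ⟨x, left_mem_segment ℝ x y⟩
    ((hf.deriv hU).continuousOn.mono hseg).norm
  calc ‖f y - f x‖ ≤ ‖deriv f z‖ * ‖y - x‖ :=
        (convex_segment x y).norm_image_sub_le_of_norm_deriv_le
          (fun w hw => hf.differentiableAt (hU.mem_nhds (hseg hw))) (fun w hw => hmax hw)
          (left_mem_segment ℝ x y) (right_mem_segment ℝ x y)
    _ < C * ‖y - x‖ :=
        mul_lt_mul_of_pos_right (hC z hz) (norm_pos_iff.mpr (sub_ne_zero.mpr hxy.symm))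

end MeanValue

section InverseFunction

variable {h : ℂ → ℂ} {U : Set ℂ}

theorem hasStrictDerivAt_deriv (hU : IsOpen U) (hd : DifferentiableOn ℂ h U) {z : ℂ}
    (hz : z ∈ U) : HasStrictDerivAt h (deriv h z) z :=
  (hd.analyticAt (hU.mem_nhds hz)).hasStrictDerivAt

theorem isOpen_image_of_deriv_ne_zero (hU : IsOpen U) (hd : DifferentiableOn ℂ h U)
    (hne : ∀ z ∈ U, deriv h z ≠ 0) : IsOpen (h '' U) := by
  rw [isOpen_iff_mem_nhds]
  rintro _ ⟨z, hz, rfl⟩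
  rw [← (hasStrictDerivAt_deriv hU hd hz).map_nhds_eq (hne z hz)]
  exact Filter.image_mem_map (hU.mem_nhds hz)

theorem hasDerivAt_invFunOn (hU : IsOpen U) (hd : DifferentiableOn ℂ h U) (hi : InjOn h U)
    {z : ℂ} (hz : z ∈ U) (hne : deriv h z ≠ 0) :
    HasDerivAt (Function.invFunOn h U) (deriv h z)⁻¹ (h z) :=
  ((hasStrictDerivAt_deriv hU hd hz).to_local_left_inverse hne
    (Filter.eventually_of_mem (hU.mem_nhds hz) fun _ hw => hi.leftInvOn_invFunOn hw)).hasDerivAt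

theorem differentiableOn_invFunOn (hU : IsOpen U) (hd : DifferentiableOn ℂ h U) (hi : InjOn h U)
    (hne : ∀ z ∈ U, deriv h z ≠ 0) :
    DifferentiableOn ℂ (Function.invFunOn h U) (h '' U) := by
  rintro _ ⟨z, hz, rfl⟩
  exact (hasDerivAt_invFunOn hU hd hi hz (hne z hz)).differentiableAt.differentiableWithinAt

end InverseFunction

section ConvexUnivalent

variable {h g : ℂ → ℂ}

theorem ConvexUnivalentOn.norm_sub_lt {U : Set ℂ} (hc : ConvexUnivalentOn h U) (hU : IsOpen U)
    (hh : DifferentiableOn ℂ h U) (hg : DifferentiableOn ℂ g U)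
    (hlt : ∀ z ∈ U, ‖deriv g z‖ < ‖deriv h z‖) {a b : ℂ} (ha : a ∈ U) (hb : b ∈ U)
    (hab : a ≠ b) : ‖g b - g a‖ < ‖h b - h a‖ := by
  have hne : ∀ z ∈ U, deriv h z ≠ 0 := fun z hz =>
    norm_pos_iff.mp ((norm_nonneg _).trans_lt (hlt z hz))
  have hinv : LeftInvOn (Function.invFunOn h U) h U := hc.1.leftInvOn_invFunOn
  have hderiv : ∀ z ∈ U,
      HasDerivAt (g ∘ Function.invFunOn h U) (deriv g z * (deriv h z)⁻¹) (h z) := fun z hz => by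
    refine HasDerivAt.comp (h z) ?_ (hasDerivAt_invFunOn hU hh hc.1 hz (hne z hz))
    rw [hinv hz]
    exact (hasStrictDerivAt_deriv hU hg hz).hasDerivAt
  have hcontract : ∀ w ∈ h '' U, ‖deriv (g ∘ Function.invFunOn h U) w‖ < 1 := by
    rintro _ ⟨z, hz, rfl⟩
    rw [(hderiv z hz).deriv, norm_mul, norm_inv, ← div_eq_mul_inv,
      div_lt_one (norm_pos_iff.mpr (hne z hz))]
    exact hlt z hz
  have hseg : segment ℝ (h a) (h b) ⊆ h '' U :=
    hc.2.segment_subset (mem_image_of_mem h ha) (mem_image_of_mem h hb)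
  have hcomp : DifferentiableOn ℂ (g ∘ Function.invFunOn h U) (h '' U) := by
    rintro _ ⟨z, hz, rfl⟩
    exact (hderiv z hz).differentiableAt.differentiableWithinAt
  simpa only [Function.comp_apply, hinv ha, hinv hb, one_mul] using
    norm_image_sub_lt_of_norm_deriv_lt (isOpen_image_of_deriv_ne_zero hU hh hne) hcomp hseg
      (fun w hw => hcontract w (hseg hw)) (hc.1.ne ha hb hab)

theorem ConvexUnivalentOn.injOn_add_conj {U : Set ℂ} (hc : ConvexUnivalentOn h U) (hU : IsOpen U)
    (hh : DifferentiableOn ℂ h U) (hg : DifferentiableOn ℂ g U)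
    (hlt : ∀ z ∈ U, ‖deriv g z‖ < ‖deriv h z‖) :
    InjOn (fun z => h z + (starRingEnd ℂ) (g z)) U := by
  intro a ha b hb hab
  by_contra hne
  have hsub : h b - h a = -(starRingEnd ℂ) (g b - g a) := by
    rw [map_sub]
    linear_combination -hab
  have hlt' := hc.norm_sub_lt hU hh hg hlt ha hb hne
  rw [hsub, norm_neg, Complex.norm_conj] at hlt'
  exact hlt'.false

theorem exists_dist_le_of_mapsTo_image_ball {F : ℂ → ℂ} {c : ℂ} {r : ℝ}
    (hd : DifferentiableOn ℂ h (ball c r)) (hi : InjOn h (ball c r))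
    (hne : ∀ z ∈ ball c r, deriv h z ≠ 0) (hF : DifferentiableOn ℂ F (ball c r))
    (hmaps : MapsTo F (ball c r) (h '' ball c r)) (hc : F c = h c) {z : ℂ} (hz : z ∈ ball c r) :
    ∃ w, dist w c ≤ dist z c ∧ h w = F z := by
  have hω : DifferentiableOn ℂ (Function.invFunOn h (ball c r) ∘ F) (ball c r) :=
    (differentiableOn_invFunOn isOpen_ball hd hi hne).comp hF hmaps
  have hωc : Function.invFunOn h (ball c r) (F c) = c := by
    rw [hc]
    exact hi.leftInvOn_invFunOn (mem_ball_self (pos_of_mem_ball hz))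
  have hωmaps : MapsTo (Function.invFunOn h (ball c r) ∘ F) (ball c r) (closedBall c r) :=
    fun w hw => ball_subset_closedBall (Function.invFunOn_mem (hmaps hw))
  refine ⟨Function.invFunOn h (ball c r) (F z), ?_, Function.invFunOn_eq (hmaps hz)⟩
  simpa only [Function.comp_apply, hωc] using
    Complex.dist_le_dist_of_mapsTo_ball hω (by rwa [Function.comp_apply, hωc]) hz

theorem ConvexUnivalentOn.exists_norm_le_eq_smul_add_smul {r : ℝ}
    (hc : ConvexUnivalentOn h (disk r)) (hd : DifferentiableOn ℂ h (disk r))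
    (hne : ∀ z ∈ disk r, deriv h z ≠ 0) {a b : ℂ} (hab : ‖a‖ ≤ ‖b‖) (hb : b ∈ disk r)
    {s t : ℝ} (hs : 0 ≤ s) (ht : 0 ≤ t) (hst : s + t = 1) :
    ∃ w, ‖w‖ ≤ ‖b‖ ∧ h w = s • h a + t • h b := by
  have hquot : ‖a / b‖ ≤ 1 := by
    rw [norm_div]
    exact div_le_one_of_le₀ hab (norm_nonneg b)
  have hscale : MapsTo (fun z => a / b * z) (disk r) (disk r) := fun z hz => by
    rw [mem_ball_zero_iff] at hz ⊢
    rw [norm_mul]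
    exact (mul_le_of_le_one_left (norm_nonneg z) hquot).trans_lt hz
  have ha : a / b * b = a := div_mul_cancel_of_imp fun hb0 => by simpa [hb0] using hab
  -- `z ↦ s h(az/b) + t h(z)` takes values in the convex set `h(𝔻_r)` and agrees with `h` at `0`.
  obtain ⟨w, hw, hwe⟩ := exists_dist_le_of_mapsTo_image_ball
    (F := fun z => s • h (a / b * z) + t • h z) hd hc.1 hne
    (((hd.comp (by fun_prop) hscale).const_smul s).add (hd.const_smul t))
    (fun z hz => hc.2 (mem_image_of_mem h (hscale hz)) (mem_image_of_mem h hz) hs ht hst)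
    (by rw [mul_zero, ← add_smul, hst, one_smul]) hb
  exact ⟨w, by simpa only [dist_zero_right] using hw, by rw [hwe, ha]⟩

/-- **Study's theorem** -/
theorem ConvexUnivalentOn.mono {r ρ : ℝ} (hc : ConvexUnivalentOn h (disk r))
    (hd : DifferentiableOn ℂ h (disk r)) (hne : ∀ z ∈ disk r, deriv h z ≠ 0) (hρ : ρ ≤ r) :
    ConvexUnivalentOn h (disk ρ) := by
  have hsub : disk ρ ⊆ disk r := ball_subset_ball hρ
  refine ⟨hc.1.mono hsub, ?_⟩
  rintro _ ⟨a, ha, rfl⟩ _ ⟨b, hb, rfl⟩ s t hs ht hst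
  wlog hab : ‖a‖ ≤ ‖b‖ generalizing a b s t
  · rw [add_comm]
    exact this b hb a ha ht hs (by rwa [add_comm]) (le_of_not_ge hab)
  obtain ⟨w, hw, hwe⟩ := hc.exists_norm_le_eq_smul_add_smul hd hne hab (hsub hb) hs ht hst
  exact ⟨w, mem_ball_zero_iff.mpr (hw.trans_lt (mem_ball_zero_iff.mp hb)), hwe⟩

end ConvexUnivalent

section Jacobian

variable {f h g : ℂ → ℂ} {h' g' z : ℂ}

theorem fderiv_add_conj_apply (hh : HasDerivAt h h' z) (hg : HasDerivAt g g' z)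
    (hf : f =ᶠ[nhds z] fun w => h w + (starRingEnd ℂ) (g w)) (v : ℂ) :
    fderiv ℝ f z v = v * h' + (starRingEnd ℂ) (v * g') := by
  have hconj := (Complex.conjCLE.toContinuousLinearMap.hasFDerivAt (x := g z)).comp z
    (hg.hasFDerivAt.restrictScalars ℝ)
  have hsum : HasFDerivAt f _ z :=
    ((hh.hasFDerivAt.restrictScalars ℝ).add hconj).congr_of_eventuallyEq hf
  simp [hsum.fderiv]

theorem wirtinger_add_conj (hh : HasDerivAt h h' z) (hg : HasDerivAt g g' z)
    (hf : f =ᶠ[nhds z] fun w => h w + (starRingEnd ℂ) (g w)) : wirtinger f z = h' := by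
  simp only [wirtinger, fderiv_add_conj_apply hh hg hf, map_mul, map_one, Complex.conj_I]
  linear_combination ((starRingEnd ℂ) g' - h') / 2 * Complex.I_sq

theorem wirtingerBar_add_conj (hh : HasDerivAt h h' z) (hg : HasDerivAt g g' z)
    (hf : f =ᶠ[nhds z] fun w => h w + (starRingEnd ℂ) (g w)) :
    wirtingerBar f z = (starRingEnd ℂ) g' := by
  simp only [wirtingerBar, fderiv_add_conj_apply hh hg hf, map_mul, map_one, Complex.conj_I]
  linear_combination (h' - (starRingEnd ℂ) g') / 2 * Complex.I_sq

theorem jacobian_add_conj (hh : HasDerivAt h h' z) (hg : HasDerivAt g g' z)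
    (hf : f =ᶠ[nhds z] fun w => h w + (starRingEnd ℂ) (g w)) :
    jacobian f z = ‖h'‖ ^ 2 - ‖g'‖ ^ 2 := by
  rw [jacobian, wirtinger_add_conj hh hg hf, wirtingerBar_add_conj hh hg hf, Complex.norm_conj]

theorem jacobian_add_conj_pos_iff (hh : HasDerivAt h h' z) (hg : HasDerivAt g g' z)
    (hf : f =ᶠ[nhds z] fun w => h w + (starRingEnd ℂ) (g w)) :
    0 < jacobian f z ↔ ‖g'‖ < ‖h'‖ := by
  rw [jacobian_add_conj hh hg hf, sub_pos, sq_lt_sq₀ (norm_nonneg _) (norm_nonneg _)]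

end Jacobian

section SchwarzPick

/-- The automorphism `w ↦ (w + a) / (1 + conj a * w)` of the unit disk, for `‖a‖ < 1`; it carries
`0` to `a`. -/
noncomputable def diskAut (a w : ℂ) : ℂ := (w + a) / (1 + (starRingEnd ℂ) a * w)

variable {a w : ℂ}

theorem diskAut_zero_right (a : ℂ) : diskAut a 0 = a := by simp [diskAut]

theorem diskAut_neg_self (a : ℂ) : diskAut (-a) a = 0 := by simp [diskAut]

theorem norm_one_add_conj_mul_sq_sub_norm_add_sq (a w : ℂ) :
    ‖1 + (starRingEnd ℂ) a * w‖ ^ 2 - ‖w + a‖ ^ 2 = (1 - ‖a‖ ^ 2) * (1 - ‖w‖ ^ 2) := by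
  rw [← Complex.ofReal_inj]
  push_cast
  simp only [← Complex.conj_mul', map_add, map_mul, map_one, Complex.conj_conj]
  ring

theorem norm_add_lt_norm_one_add_conj_mul (ha : a ∈ disk 1) (hw : w ∈ disk 1) :
    ‖w + a‖ < ‖1 + (starRingEnd ℂ) a * w‖ := by
  rw [mem_ball_zero_iff] at ha hw
  rw [← sq_lt_sq₀ (norm_nonneg _) (norm_nonneg _), ← sub_pos,
    norm_one_add_conj_mul_sq_sub_norm_add_sq]
  exact mul_pos (sub_pos.mpr (pow_lt_one₀ (norm_nonneg a) ha two_ne_zero))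
    (sub_pos.mpr (pow_lt_one₀ (norm_nonneg w) hw two_ne_zero))

theorem one_add_conj_mul_ne_zero (ha : a ∈ disk 1) (hw : w ∈ disk 1) :
    1 + (starRingEnd ℂ) a * w ≠ 0 :=
  norm_pos_iff.mp ((norm_nonneg _).trans_lt (norm_add_lt_norm_one_add_conj_mul ha hw))

theorem hasDerivAt_diskAut (ha : a ∈ disk 1) (hw : w ∈ disk 1) :
    HasDerivAt (diskAut a) ((1 - ‖a‖ ^ 2) / (1 + (starRingEnd ℂ) a * w) ^ 2) w := by
  refine (((hasDerivAt_id w).add_const a).div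
    (((hasDerivAt_id w).const_mul ((starRingEnd ℂ) a)).const_add 1)
    (one_add_conj_mul_ne_zero ha hw)).congr_deriv ?_
  rw [← Complex.conj_mul']
  simp only [id]
  ring

theorem isSelfMap_diskAut (ha : a ∈ disk 1) : IsSelfMap (diskAut a) where
  analytic _ hw := (hasDerivAt_diskAut ha hw).differentiableAt.differentiableWithinAt
  mapsTo w hw := by
    have hlt := norm_add_lt_norm_one_add_conj_mul ha hw
    rw [mem_ball_zero_iff, diskAut, norm_div]
    exact (div_lt_one ((norm_nonneg _).trans_lt hlt)).mpr hlt

theorem hasDerivAt_diskAut_zero (ha : a ∈ disk 1) :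
    HasDerivAt (diskAut a) (1 - ‖a‖ ^ 2) 0 := by
  simpa only [mul_zero, add_zero, one_pow, div_one] using
    hasDerivAt_diskAut ha (mem_ball_self one_pos)

theorem hasDerivAt_diskAut_neg_self (ha : a ∈ disk 1) :
    HasDerivAt (diskAut (-a)) (1 - (‖a‖ : ℂ) ^ 2)⁻¹ a := by
  have hneg : -a ∈ disk 1 := by simpa using ha
  have hne := one_add_conj_mul_ne_zero hneg ha
  refine (hasDerivAt_diskAut hneg ha).congr_deriv ?_
  rw [map_neg, neg_mul, Complex.conj_mul', ← sub_eq_add_neg] at hne ⊢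
  rw [norm_neg]
  field_simp

theorem IsSelfMap.comp {φ χ : ℂ → ℂ} (hφ : IsSelfMap φ) (hχ : IsSelfMap χ) :
    IsSelfMap (φ ∘ χ) :=
  ⟨hφ.analytic.comp hχ.analytic hχ.mapsTo, hφ.mapsTo.comp hχ.mapsTo⟩

theorem IsSelfMap.hasDerivAt {φ : ℂ → ℂ} (hφ : IsSelfMap φ) {z : ℂ} (hz : z ∈ disk 1) :
    HasDerivAt φ (deriv φ z) z :=
  (hφ.analytic.differentiableAt (isOpen_ball.mem_nhds hz)).hasDerivAt

theorem IsSelfMap.norm_le {ω : ℂ → ℂ} (hω : IsSelfMap ω) (h0 : ω 0 = 0) {z : ℂ}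
    (hz : z ∈ disk 1) : ‖ω z‖ ≤ ‖z‖ :=
  Complex.norm_le_norm_of_mapsTo_ball hω.analytic (hω.mapsTo.mono_right ball_subset_closedBall) h0
    (mem_ball_zero_iff.mp hz)

/-- The **Schwarz-Pick lemma**, in infinitesimal form -/
theorem IsSelfMap.norm_deriv_mul_le {φ : ℂ → ℂ} (hφ : IsSelfMap φ) {z : ℂ} (hz : z ∈ disk 1) :
    ‖deriv φ z‖ * (1 - ‖z‖ ^ 2) ≤ 1 - ‖φ z‖ ^ 2 := by
  have hpos : ∀ {w : ℂ}, w ∈ disk 1 → 0 < 1 - ‖w‖ ^ 2 := fun hw =>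
    sub_pos.mpr (pow_lt_one₀ (norm_nonneg _) (mem_ball_zero_iff.mp hw) two_ne_zero)
  have hφz := hφ.mapsTo hz
  have hneg : -φ z ∈ disk 1 := by simpa using hφz
  have hself : IsSelfMap (diskAut (-φ z) ∘ φ ∘ diskAut z) :=
    (isSelfMap_diskAut hneg).comp (hφ.comp (isSelfMap_diskAut hz))
  have hfix : (diskAut (-φ z) ∘ φ ∘ diskAut z) 0 = 0 := by
    simp only [Function.comp_apply, diskAut_zero_right, diskAut_neg_self]
  have hderiv : HasDerivAt (diskAut (-φ z) ∘ φ ∘ diskAut z)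
      ((1 - (‖φ z‖ : ℂ) ^ 2)⁻¹ * (deriv φ z * (1 - (‖z‖ : ℂ) ^ 2))) 0 := by
    refine HasDerivAt.comp 0 ?_ (HasDerivAt.comp 0 ?_ (hasDerivAt_diskAut_zero hz))
    · simpa only [Function.comp_apply, diskAut_zero_right] using hasDerivAt_diskAut_neg_self hφz
    · simpa only [diskAut_zero_right] using hφ.hasDerivAt hz
  have hle := Complex.norm_deriv_le_one_of_mapsTo_ball hself.analytic
    (by rw [hfix]; exact hself.mapsTo.mono_right ball_subset_closedBall) one_pos
  have hnorm : ∀ {w : ℂ}, w ∈ disk 1 → ‖1 - (‖w‖ : ℂ) ^ 2‖ = 1 - ‖w‖ ^ 2 := fun hw => by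
    exact_mod_cast Complex.norm_of_nonneg (hpos hw).le
  rwa [hderiv.deriv, norm_mul, norm_inv, norm_mul, hnorm hφz, hnorm hz,
    inv_mul_le_one₀ (hpos hφz)] at hle

end SchwarzPick

section MinimumModulus

theorem le_norm_of_forall_mem_frontier_le_norm {E : Type*} [NormedAddCommGroup E]
    [NormedSpace ℂ E] [Nontrivial E] {f : E → ℂ} {U : Set E} {C : ℝ} (hU : Bornology.IsBounded U)
    (hf : DiffContOnCl ℂ f U) (hne : ∀ z ∈ closure U, f z ≠ 0)
    (hC : ∀ z ∈ frontier U, C ≤ ‖f z‖) {z : E} (hz : z ∈ closure U) : C ≤ ‖f z‖ := by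
  rcases le_or_gt C 0 with hC0 | hC0
  · exact hC0.trans (norm_nonneg _)
  have hinv : ‖f⁻¹ z‖ ≤ C⁻¹ :=
    Complex.norm_le_of_forall_mem_frontier_norm_le hU (hf.inv hne)
      (fun w hw => by
        rw [Pi.inv_apply, norm_inv]
        exact inv_anti₀ hC0 (hC w hw)) hz
  rw [Pi.inv_apply, norm_inv] at hinv
  exact (inv_le_inv₀ (norm_pos_iff.mpr (hne z hz)) hC0).mp hinv

variable {f : ℂ → ℂ} {r R : ℝ}

theorem minModulus_le_norm_of_mem_sphere {z : ℂ} (hz : z ∈ sphere 0 r) :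
    minModulus f r ≤ ‖f z‖ :=
  csInf_le ⟨0, forall_mem_image.mpr fun _ _ => norm_nonneg _⟩ (mem_image_of_mem _ hz)

theorem exists_norm_eq_minModulus (hf : ContinuousOn f (disk R)) (hr : r ∈ Ico 0 R) :
    ∃ z ∈ sphere 0 r, ‖f z‖ = minModulus f r := by
  obtain ⟨z, hz, he, -⟩ := (isCompact_sphere (0 : ℂ) r).exists_sInf_image_eq_and_le
    (NormedSpace.sphere_nonempty.mpr hr.1)
    (hf.mono (sphere_subset_closedBall.trans (closedBall_subset_ball hr.2))).norm
  exact ⟨z, hz, he.symm⟩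

theorem minModulus_pos (hf : ContinuousOn f (disk R)) (hne : ∀ z ∈ disk R, f z ≠ 0)
    (hr : r ∈ Ico 0 R) : 0 < minModulus f r := by
  obtain ⟨z, hz, he⟩ := exists_norm_eq_minModulus hf hr
  rw [← he]
  exact norm_pos_iff.mpr (hne z (sphere_subset_ball hr.2 hz))

theorem minModulus_le_norm (hf : DifferentiableOn ℂ f (disk R)) (hne : ∀ z ∈ disk R, f z ≠ 0)
    (hr : r < R) {z : ℂ} (hz : ‖z‖ ≤ r) : minModulus f r ≤ ‖f z‖ := by
  rcases ((norm_nonneg z).trans hz).eq_or_lt with rfl | hr0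
  · exact minModulus_le_norm_of_mem_sphere
      (mem_sphere_zero_iff_norm.mpr (le_antisymm hz (norm_nonneg z)))
  have hclosure : closure (disk r) ⊆ disk R :=
    closure_ball_subset_closedBall.trans (closedBall_subset_ball hr)
  refine le_norm_of_forall_mem_frontier_le_norm isBounded_ball
    (hf.mono hclosure).diffContOnCl (fun w hw => hne w (hclosure hw))
    (fun w hw => minModulus_le_norm_of_mem_sphere (frontier_ball_subset_sphere hw)) ?_
  rw [closure_ball _ hr0.ne']
  exact mem_closedBall_zero_iff.mpr hz

theorem antitoneOn_minModulus (hf : DifferentiableOn ℂ f (disk R))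
    (hne : ∀ z ∈ disk R, f z ≠ 0) : AntitoneOn (minModulus f) (Ico 0 R) := by
  intro r hr s hs hrs
  obtain ⟨z, hz, he⟩ := exists_norm_eq_minModulus hf.continuousOn hr
  rw [← he]
  exact minModulus_le_norm hf hne hs.2 ((mem_sphere_zero_iff_norm.mp hz).trans_le hrs)

theorem minModulus_eq_sInf_unit_sphere (f : ℂ → ℂ) (hr : 0 ≤ r) :
    minModulus f r = sInf ((fun u : ℂ => ‖f (r • u)‖) '' sphere 0 1) := by
  have hsphere : sphere (0 : ℂ) r = (fun u => r • u) '' sphere 0 1 := by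
    rw [Set.image_smul, smul_sphere r 0 zero_le_one, smul_zero, mul_one,
      Real.norm_of_nonneg hr]
  rw [minModulus, hsphere, image_image]

theorem continuousOn_minModulus (hf : ContinuousOn f (disk R)) :
    ContinuousOn (minModulus f) (Ico 0 R) := by
  rw [continuousOn_iff_continuous_domRestrict]
  have hcont : Continuous fun p : Ico 0 R × sphere (0 : ℂ) 1 => ‖f ((p.1 : ℝ) • (p.2 : ℂ))‖ := by
    refine (hf.comp_continuous (by fun_prop) fun p => ?_).norm
    rw [mem_ball_zero_iff, norm_smul, mem_sphere_zero_iff_norm.mp p.2.2, mul_one,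
      Real.norm_of_nonneg p.1.2.1]
    exact p.1.2.2
  convert isCompact_univ.continuous_sInf
    (f := fun (r : Ico 0 R) (u : sphere (0 : ℂ) 1) => ‖f ((r : ℝ) • (u : ℂ))‖) hcont using 2 with r
  rw [domRestrict_apply, minModulus_eq_sInf_unit_sphere f r.2.1, image_univ,
    image_eq_range]

end MinimumModulus

section RadiusEquation

/-- The left-hand side `(1 - r²) m(r) - 2 r` of the equation that determines the radius `r_ψ`. -/
noncomputable def radiusGap (ψ : ℂ → ℂ) (r : ℝ) : ℝ := (1 - r ^ 2) * minModulus ψ r - 2 * r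

variable {ψ : ℂ → ℂ}

theorem continuousOn_radiusGap (hψ : ContinuousOn ψ (disk 1)) :
    ContinuousOn (radiusGap ψ) (Ico 0 1) := by
  have := continuousOn_minModulus hψ
  unfold radiusGap
  fun_prop

theorem strictAntiOn_radiusGap (hψ : DifferentiableOn ℂ ψ (disk 1))
    (hne : ∀ z ∈ disk 1, ψ z ≠ 0) : StrictAntiOn (radiusGap ψ) (Ico 0 1) := by
  intro r hr s hs hrs
  have hfactor : 1 - s ^ 2 ≤ 1 - r ^ 2 := by nlinarith [hr.1, hs.1]
  have hnonneg : 0 ≤ 1 - r ^ 2 := by nlinarith [hr.1, hr.2]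
  have hmul := mul_le_mul hfactor (antitoneOn_minModulus hψ hne hr hs hrs.le)
    (minModulus_pos hψ.continuousOn hne hs).le hnonneg
  rw [radiusGap, radiusGap]
  linarith

theorem exists_radiusGap_nonpos (hψ : DifferentiableOn ℂ ψ (disk 1))
    (hne : ∀ z ∈ disk 1, ψ z ≠ 0) : ∃ r ∈ Ico (0 : ℝ) 1, radiusGap ψ r ≤ 0 := by
  have hmem : (0 : ℝ) ∈ Ico (0 : ℝ) 1 := ⟨le_rfl, one_pos⟩
  set M := minModulus ψ 0
  have hM : 0 < M := minModulus_pos hψ.continuousOn hne hmem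
  -- At this `r` the bound `(1 - r²) M - 2 r` of the gap equals `-M / (1 + M)²`.
  have hr : M / (1 + M) ∈ Ico (0 : ℝ) 1 :=
    ⟨by positivity, (div_lt_one (by positivity)).mpr (by linarith)⟩
  refine ⟨M / (1 + M), hr, ?_⟩
  have hle : (1 - (M / (1 + M)) ^ 2) * minModulus ψ (M / (1 + M)) ≤
      (1 - (M / (1 + M)) ^ 2) * M :=
    mul_le_mul_of_nonneg_left (antitoneOn_minModulus hψ hne hmem hr hr.1)
      (sub_nonneg.mpr (pow_le_one₀ hr.1 hr.2.le))
  have heq : (1 - (M / (1 + M)) ^ 2) * M - 2 * (M / (1 + M)) = -(M / (1 + M) ^ 2) := by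
    field_simp
    ring
  have hneg : 0 < M / (1 + M) ^ 2 := by positivity
  rw [radiusGap]
  linarith

theorem existsUnique_isRadiusRoot (hψ : DifferentiableOn ℂ ψ (disk 1))
    (hne : ∀ z ∈ disk 1, ψ z ≠ 0) : ∃! r : ℝ, IsRadiusRoot ψ r := by
  obtain ⟨b, hb, hgb⟩ := exists_radiusGap_nonpos hψ hne
  have hsub : Icc 0 b ⊆ Ico 0 1 := Icc_subset_Ico_right hb.2
  have hg0 : 0 < radiusGap ψ 0 := by
    simpa [radiusGap] using minModulus_pos hψ.continuousOn hne ⟨le_rfl, one_pos⟩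
  obtain ⟨r, hr, hroot⟩ := intermediate_value_Icc' hb.1
    ((continuousOn_radiusGap hψ.continuousOn).mono hsub) ⟨hgb, hg0.le⟩
  have hr0 : 0 < r := hr.1.lt_of_ne fun h => hg0.ne' (h ▸ hroot)
  refine ⟨r, ⟨hr0, (hsub hr).2, hroot⟩, fun s hs => ?_⟩
  exact (strictAntiOn_radiusGap hψ hne).injOn ⟨hs.1.le, hs.2.1⟩ (hsub hr)
    (hs.2.2.trans hroot.symm)

theorem IsRadiusRoot.radiusGap_pos {r s : ℝ} (hs : IsRadiusRoot ψ s)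
    (hψ : DifferentiableOn ℂ ψ (disk 1)) (hne : ∀ z ∈ disk 1, ψ z ≠ 0) (hr : 0 ≤ r)
    (hrs : r < s) : 0 < radiusGap ψ r :=
  hs.2.2.symm.trans_lt
    (strictAntiOn_radiusGap hψ hne ⟨hr, hrs.trans hs.2.1⟩ ⟨hs.1.le, hs.2.1⟩ hrs)

theorem IsRadiusRoot.radiusGap_neg {r s : ℝ} (hr : IsRadiusRoot ψ r)
    (hψ : DifferentiableOn ℂ ψ (disk 1)) (hne : ∀ z ∈ disk 1, ψ z ≠ 0) (hrs : r < s)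
    (hs : s < 1) : radiusGap ψ s < 0 :=
  (strictAntiOn_radiusGap hψ hne ⟨hr.1.le, hr.2.1⟩ ⟨hr.1.le.trans hrs.le, hs⟩ hrs).trans_eq
    hr.2.2

end RadiusEquation

section Starlike

variable {ψ h φ f : ℂ → ℂ} {z : ℂ}

theorem MaMindaStarlike.hasDerivAt (hh : MaMindaStarlike ψ h) (hz : z ∈ disk 1) :
    HasDerivAt h (deriv h z) z :=
  (hh.analytic.differentiableAt (isOpen_ball.mem_nhds hz)).hasDerivAt

theorem MaMindaStarlike.exists_mul_deriv_eq (hh : MaMindaStarlike ψ h) (hz : z ∈ disk 1) :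
    ∃ w, ‖w‖ ≤ ‖z‖ ∧ z * deriv h z = ψ w * h z := by
  obtain ⟨ω, hω, hω0, hquot⟩ := hh.subordinate
  refine ⟨ω z, hω.norm_le hω0 hz, ?_⟩
  rcases eq_or_ne z 0 with rfl | hz0
  · rw [hh.map_zero, zero_mul, mul_zero]
  · rw [← hquot z hz, starQuotient, if_neg hz0, div_mul_cancel₀ _ (hh.ne_zero z hz hz0)]

theorem MaMindaStarlike.deriv_ne_zero (hh : MaMindaStarlike ψ h)
    (hne : ∀ z ∈ disk 1, ψ z ≠ 0) (hz : z ∈ disk 1) : deriv h z ≠ 0 := by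
  rcases eq_or_ne z 0 with rfl | hz0
  · rw [hh.deriv_zero]
    exact one_ne_zero
  obtain ⟨w, hw, hmul⟩ := hh.exists_mul_deriv_eq hz
  have hw1 : w ∈ disk 1 := mem_ball_zero_iff.mpr (hw.trans_lt (mem_ball_zero_iff.mp hz))
  exact right_ne_zero_of_mul (hmul ▸ mul_ne_zero (hne w hw1) (hh.ne_zero z hz hz0))

theorem MaMindaStarlike.minModulus_mul_norm_le (hh : MaMindaStarlike ψ h)
    (hψ : DifferentiableOn ℂ ψ (disk 1)) (hne : ∀ z ∈ disk 1, ψ z ≠ 0) (hz : z ∈ disk 1) :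
    minModulus ψ ‖z‖ * ‖h z‖ ≤ ‖z‖ * ‖deriv h z‖ := by
  obtain ⟨w, hw, hmul⟩ := hh.exists_mul_deriv_eq hz
  rw [← norm_mul, hmul, norm_mul]
  exact mul_le_mul_of_nonneg_right (minModulus_le_norm hψ hne (mem_ball_zero_iff.mp hz) hw)
    (norm_nonneg _)

theorem MaMindaStarlike.two_mul_norm_deriv_mul_norm_le (hh : MaMindaStarlike ψ h)
    (hψ : DifferentiableOn ℂ ψ (disk 1)) (hne : ∀ z ∈ disk 1, ψ z ≠ 0) (hφ : IsSelfMap φ)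
    (hz : z ∈ disk 1) (hgap : 0 ≤ radiusGap ψ ‖z‖) :
    2 * (‖deriv φ z‖ * ‖h z‖) ≤ (1 - ‖φ z‖ ^ 2) * ‖deriv h z‖ := by
  have hz1 : ‖z‖ < 1 := mem_ball_zero_iff.mp hz
  have hφ1 : ‖φ z‖ < 1 := mem_ball_zero_iff.mp (hφ.mapsTo hz)
  have hm : 0 < minModulus ψ ‖z‖ := minModulus_pos hψ.continuousOn hne ⟨norm_nonneg z, hz1⟩
  have hK : 0 < (1 - ‖z‖ ^ 2) * minModulus ψ ‖z‖ :=
    mul_pos (sub_pos.mpr (pow_lt_one₀ (norm_nonneg z) hz1 two_ne_zero)) hm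
  have hφ2 : 0 ≤ 1 - ‖φ z‖ ^ 2 := sub_nonneg.mpr (pow_le_one₀ (norm_nonneg _) hφ1.le)
  refine le_of_mul_le_mul_left ?_ hK
  calc (1 - ‖z‖ ^ 2) * minModulus ψ ‖z‖ * (2 * (‖deriv φ z‖ * ‖h z‖))
      = 2 * ((‖deriv φ z‖ * (1 - ‖z‖ ^ 2)) * (minModulus ψ ‖z‖ * ‖h z‖)) := by ring
    _ ≤ 2 * ((1 - ‖φ z‖ ^ 2) * (‖z‖ * ‖deriv h z‖)) :=
        mul_le_mul_of_nonneg_left (mul_le_mul (hφ.norm_deriv_mul_le hz)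
          (hh.minModulus_mul_norm_le hψ hne hz) (by positivity) hφ2) zero_le_two
    _ = 2 * ‖z‖ * ((1 - ‖φ z‖ ^ 2) * ‖deriv h z‖) := by ring
    _ ≤ (1 - ‖z‖ ^ 2) * minModulus ψ ‖z‖ * ((1 - ‖φ z‖ ^ 2) * ‖deriv h z‖) :=
        mul_le_mul_of_nonneg_right (sub_nonneg.mp hgap) (mul_nonneg hφ2 (norm_nonneg _))

theorem MaMindaStarlike.norm_deriv_mul_lt (hh : MaMindaStarlike ψ h)
    (hψ : DifferentiableOn ℂ ψ (disk 1)) (hne : ∀ z ∈ disk 1, ψ z ≠ 0) (hφ : IsSelfMap φ)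
    (hz : z ∈ disk 1) (hgap : 0 ≤ radiusGap ψ ‖z‖) :
    ‖deriv (fun w => φ w * h w) z‖ < ‖deriv h z‖ := by
  have hφ1 : ‖φ z‖ < 1 := mem_ball_zero_iff.mp (hφ.mapsTo hz)
  have hpos : 0 < ‖deriv h z‖ := norm_pos_iff.mpr (hh.deriv_ne_zero hne hz)
  have hle : ‖deriv (fun w => φ w * h w) z‖ ≤ ‖deriv φ z‖ * ‖h z‖ + ‖φ z‖ * ‖deriv h z‖ := by
    rw [((hφ.hasDerivAt hz).fun_mul (hh.hasDerivAt hz)).deriv, ← norm_mul, ← norm_mul]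
    exact norm_add_le _ _
  have hSchwarz := hh.two_mul_norm_deriv_mul_norm_le hψ hne hφ hz hgap
  -- `|φ| + (1 - |φ|²) / 2 = 1 - (1 - |φ|)² / 2`
  have hsq : 0 < (1 - ‖φ z‖) ^ 2 * ‖deriv h z‖ :=
    mul_pos (pow_pos (sub_pos.mpr hφ1) 2) hpos
  linarith

theorem MaMindaStarlike.convexUnivalentOn (hh : MaMindaStarlike ψ h)
    (hne : ∀ z ∈ disk 1, ψ z ≠ 0) {r : ℝ} (hr0 : 0 ≤ r) (hr : r < radiusOfConvexity ψ) :
    ConvexUnivalentOn h (disk r) := by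
  -- Were no radius admissible, the radius of convexity would be `sSup ∅ = 0`.
  have hnonempty : {s : ℝ | 0 < s ∧ s ≤ 1 ∧
      ∀ h, MaMindaStarlike ψ h → ConvexUnivalentOn h (disk s)}.Nonempty := by
    by_contra hempty
    rw [radiusOfConvexity, not_nonempty_iff_eq_empty.mp hempty, Real.sSup_empty] at hr
    exact hr.not_ge hr0
  obtain ⟨s, ⟨-, hs1, hs⟩, hrs⟩ := exists_lt_of_lt_csSup hnonempty hr
  have hsub : disk s ⊆ disk 1 := ball_subset_ball hs1
  exact (hs h hh).mono (hh.analytic.mono hsub) (fun z hz => hh.deriv_ne_zero hne (hsub hz)) hrs.le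

theorem HarmonicClass.exists_eqOn (hf : HarmonicClass ψ f) :
    ∃ h φ, MaMindaStarlike ψ h ∧ IsSelfMap φ ∧
      EqOn f (fun z => h z + (starRingEnd ℂ) (φ z * h z)) (disk 1) := by
  obtain ⟨h, g, φ, hh, hφ, hg, hfhg⟩ := hf
  exact ⟨h, φ, hh, hφ, fun z hz => by rw [hfhg z hz, hg z hz]⟩

theorem HarmonicClass.sensePreservingOn (hf : HarmonicClass ψ f)
    (hψ : DifferentiableOn ℂ ψ (disk 1)) (hne : ∀ z ∈ disk 1, ψ z ≠ 0) {r : ℝ}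
    (hr : IsRadiusRoot ψ r) : SensePreservingOn f (disk r) := by
  obtain ⟨h, φ, hh, hφ, heq⟩ := hf.exists_eqOn
  intro z hz
  have hz1 : z ∈ disk 1 := ball_subset_ball hr.2.1.le hz
  have hg := (hφ.hasDerivAt hz1).fun_mul (hh.hasDerivAt hz1)
  rw [jacobian_add_conj_pos_iff (hh.hasDerivAt hz1) hg
    (heq.eventuallyEq_of_mem (isOpen_ball.mem_nhds hz1)), ← hg.deriv]
  exact hh.norm_deriv_mul_lt hψ hne hφ hz1
    (hr.radiusGap_pos hψ hne (norm_nonneg z) (mem_ball_zero_iff.mp hz)).le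

theorem HarmonicClass.injOn (hf : HarmonicClass ψ f) (hψ : DifferentiableOn ℂ ψ (disk 1))
    (hne : ∀ z ∈ disk 1, ψ z ≠ 0) {r : ℝ} (hr : IsRadiusRoot ψ r) :
    InjOn f (disk (min r (radiusOfConvexity ψ))) := by
  obtain ⟨h, φ, hh, hφ, heq⟩ := hf.exists_eqOn
  intro a ha b hb hab
  obtain ⟨t, hmax, hmin⟩ := exists_between
    (max_lt (mem_ball_zero_iff.mp ha) (mem_ball_zero_iff.mp hb))
  obtain ⟨hat, hbt⟩ := max_lt_iff.mp hmax
  obtain ⟨htr, htc⟩ := lt_min_iff.mp hmin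
  have hsub : disk t ⊆ disk 1 := ball_subset_ball (htr.trans hr.2.1).le
  have hconvex : ConvexUnivalentOn h (disk t) :=
    hh.convexUnivalentOn hne ((norm_nonneg a).trans hat.le) htc
  have hinj := hconvex.injOn_add_conj isOpen_ball (hh.analytic.mono hsub)
    ((hφ.analytic.mul hh.analytic).mono hsub) fun z hz =>
      hh.norm_deriv_mul_lt hψ hne hφ (hsub hz)
        (hr.radiusGap_pos hψ hne (norm_nonneg z) ((mem_ball_zero_iff.mp hz).trans htr)).le
  exact (hinj.congr (heq.symm.mono hsub)) (mem_ball_zero_iff.mpr hat) (mem_ball_zero_iff.mpr hbt)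
    hab

end Starlike

section Extremal

theorem im_eq_im_of_hasDerivAt {P q : ℂ → ℂ} {a b : ℝ} (hab : a ≤ b)
    (hP : ∀ t ∈ Icc a b, HasDerivAt P (q t) t) (hq : ∀ t ∈ Ico a b, (q t).im = 0) :
    (P b).im = (P a).im := by
  have him : ∀ t ∈ Icc a b, HasDerivAt (fun t : ℝ => (P t).im) (q t).im t := fun t ht =>
    Complex.imCLM.hasFDerivAt.comp_hasDerivAt t (hP t ht).comp_ofReal
  refine constant_of_has_deriv_right_zero (f := fun t : ℝ => (P t).im)
    (fun t ht => (him t ht).continuousAt.continuousWithinAt) (fun t ht => ?_) b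
    (right_mem_Icc.mpr hab)
  simpa only [hq t ht] using (him t (Ico_subset_Icc_self ht)).hasDerivWithinAt

variable {ψ P : ℂ → ℂ}

theorem mul_dslope_zero (h0 : ψ 0 = 1) (z : ℂ) : z * dslope ψ 0 z = ψ z - 1 := by
  simpa only [sub_zero, smul_eq_mul, h0] using sub_smul_dslope ψ 0 z

theorem exists_primitive_dslope (hψ : DifferentiableOn ℂ ψ (disk 1)) :
    ∃ P : ℂ → ℂ, P 0 = 0 ∧ ∀ z ∈ disk 1, HasDerivAt P (dslope ψ 0 z) z :=
  ((Complex.differentiableOn_dslope (ball_mem_nhds 0 one_pos)).mpr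
    hψ).isExactOn_ball.with_val_at 0 0

theorem hasDerivAt_mul_exp_primitive (h0 : ψ 0 = 1) {z : ℂ}
    (hP : HasDerivAt P (dslope ψ 0 z) z) :
    HasDerivAt (fun z => z * Complex.exp (P z)) (ψ z * Complex.exp (P z)) z := by
  refine ((hasDerivAt_id z).fun_mul hP.cexp).congr_deriv ?_
  simp only [id]
  linear_combination Complex.exp (P z) * mul_dslope_zero h0 z

theorem maMindaStarlike_mul_exp_primitive (h0 : ψ 0 = 1) (hP0 : P 0 = 0)
    (hP : ∀ z ∈ disk 1, HasDerivAt P (dslope ψ 0 z) z) :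
    MaMindaStarlike ψ fun z => z * Complex.exp (P z) where
  analytic z hz :=
    (hasDerivAt_mul_exp_primitive h0 (hP z hz)).differentiableAt.differentiableWithinAt
  map_zero := zero_mul _
  deriv_zero := by
    rw [(hasDerivAt_mul_exp_primitive h0 (hP 0 (mem_ball_self one_pos))).deriv, h0, hP0,
      Complex.exp_zero, mul_one]
  ne_zero z _ hz0 := mul_ne_zero hz0 (Complex.exp_ne_zero _)
  subordinate := by
    refine ⟨id, ⟨differentiableOn_id, mapsTo_id _⟩, rfl, fun z hz => ?_⟩
    rcases eq_or_ne z 0 with rfl | hz0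
    · rw [starQuotient, if_pos rfl, id, h0]
    · rw [starQuotient, if_neg hz0, (hasDerivAt_mul_exp_primitive h0 (hP z hz)).deriv, id,
        div_eq_iff (mul_ne_zero hz0 (Complex.exp_ne_zero _))]
      ring

theorem ofReal_mem_disk {t r : ℝ} : (t : ℂ) ∈ disk r ↔ |t| < r := by
  rw [mem_ball_zero_iff, Complex.norm_real, Real.norm_eq_abs]

theorem exp_primitive_eq_ofReal (h0 : ψ 0 = 1) (hP0 : P 0 = 0)
    (hP : ∀ z ∈ disk 1, HasDerivAt P (dslope ψ 0 z) z)
    (hreal : ∀ t ∈ Ioo (-1 : ℝ) 0, (ψ t).im = 0) {t : ℝ} (ht : t ∈ Ioc (-1) 0) :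
    Complex.exp (P t) = Real.exp (P t).re := by
  have hq : ∀ s ∈ Ico t 0, (dslope ψ 0 (s : ℂ)).im = 0 := fun s hs => by
    have him := congrArg Complex.im (mul_dslope_zero h0 (s : ℂ))
    rw [Complex.im_ofReal_mul, Complex.sub_im, hreal s ⟨ht.1.trans_le hs.1, hs.2⟩,
      Complex.one_im, sub_zero] at him
    exact (mul_eq_zero.mp him).resolve_left hs.2.ne
  have him : (P t).im = 0 := by
    rw [← im_eq_im_of_hasDerivAt (P := P) (q := dslope ψ 0) ht.2
      (fun s hs => hP s (ofReal_mem_disk.mpr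
        (abs_lt.mpr ⟨ht.1.trans_le hs.1, hs.2.trans_lt one_pos⟩))) hq,
      Complex.ofReal_zero, hP0, Complex.zero_im]
  rw [Complex.ofReal_exp]
  exact congrArg Complex.exp (Complex.ext rfl him)

theorem exists_maMindaStarlike_ofReal (hψ : DifferentiableOn ℂ ψ (disk 1)) (h0 : ψ 0 = 1)
    (hreal : ∀ t ∈ Ioo (-1 : ℝ) 0, (ψ t).im = 0) :
    ∃ h, MaMindaStarlike ψ h ∧ ∃ E : ℝ → ℝ, ∀ t ∈ Ioc (-1) 0,
      0 < E t ∧ h t = (t * E t : ℝ) ∧ HasDerivAt h (ψ t * E t) t := by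
  obtain ⟨P, hP0, hP⟩ := exists_primitive_dslope hψ
  refine ⟨fun z => z * Complex.exp (P z), maMindaStarlike_mul_exp_primitive h0 hP0 hP,
    fun t => Real.exp (P t).re, fun t ht => ?_⟩
  have hexp := exp_primitive_eq_ofReal h0 hP0 hP hreal ht
  have hmem : (t : ℂ) ∈ disk 1 :=
    ofReal_mem_disk.mpr (abs_lt.mpr ⟨ht.1, ht.2.trans_lt one_pos⟩)
  refine ⟨Real.exp_pos _, ?_, ?_⟩
  · rw [Complex.ofReal_mul, ← hexp]
  · rw [← hexp]
    exact hasDerivAt_mul_exp_primitive h0 (hP t hmem)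

end Extremal

section Sharpness

theorem not_injOn_Icc_of_hasDerivAt_neg {F : ℝ → ℝ} {F' a b c : ℝ} (hF : ContinuousOn F (Icc a b))
    (hab : F a ≤ F b) (hc : c ∈ Ioo a b) (hF' : HasDerivAt F F' c) (hneg : F' < 0) :
    ¬InjOn F (Icc a b) := by
  intro hinj
  have hmono := hF.strictMonoOn_of_injOn_Icc (hc.1.trans hc.2).le hab hinj
  have hnonneg := hmono.monotoneOn.derivWithin_nonneg (x := c)
  rw [derivWithin_of_mem_nhds (Icc_mem_nhds hc.1 hc.2), hF'.deriv] at hnonneg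
  exact hneg.not_ge hnonneg

variable {h g : ℂ → ℂ}

theorem not_injOn_add_conj_of_ofReal {U : Set ℂ} {a b c p q : ℝ} (hU : IsOpen U)
    (hh : DifferentiableOn ℂ h U) (hg : DifferentiableOn ℂ g U)
    (hmem : ∀ t ∈ Icc a b, (t : ℂ) ∈ U) (him : ∀ t ∈ Icc a b, (h t).im = 0 ∧ (g t).im = 0)
    (hab : (h a + g a).re ≤ (h b + g b).re) (hc : c ∈ Ioo a b) (hp : HasDerivAt h p c)
    (hq : HasDerivAt g q c) (hpq : p + q < 0) :
    ¬InjOn (fun z => h z + (starRingEnd ℂ) (g z)) U := by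
  intro hinj
  have hcont : ContinuousOn (fun t : ℝ => (h t + g t).re) (Icc a b) := fun t ht =>
    (((hh.add hg).differentiableAt (hU.mem_nhds (hmem t ht))).hasDerivAt.real_of_complex
      ).continuousAt.continuousWithinAt
  refine not_injOn_Icc_of_hasDerivAt_neg hcont hab hc (hp.add hq).real_of_complex
    (by simpa using hpq) fun s hs t ht hst => ?_
  refine Complex.ofReal_injective (hinj (hmem s hs) (hmem t ht) (Complex.ext ?_ ?_))
  · simpa using hst
  · simp [him s hs, him t ht]

theorem not_jacobian_add_conj_pos {z : ℂ} {p q : ℝ} (hp : HasDerivAt h p z)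
    (hq : HasDerivAt g q z) (hp0 : 0 ≤ p) (hpq : p + q < 0) :
    ¬0 < jacobian (fun w => h w + (starRingEnd ℂ) (g w)) z := by
  rw [jacobian_add_conj_pos_iff hp hq .rfl, Complex.norm_real, Complex.norm_real, not_lt,
    Real.norm_of_nonneg hp0]
  exact (by linarith : p ≤ -q).trans (neg_le_abs q)

theorem diskAut_ofReal (a t : ℝ) : diskAut a t = ((t + a) / (1 + a * t) : ℝ) := by
  rw [diskAut, Complex.conj_ofReal]
  push_cast
  rfl

theorem one_add_mul_pos {a t : ℝ} (ha : |a| < 1) (ht : |t| < 1) : 0 < 1 + a * t := by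
  have hlt : |a * t| < 1 := by
    rw [abs_mul]
    exact mul_lt_one_of_nonneg_of_lt_one_left (abs_nonneg a) ha ht.le
  linarith [neg_lt_of_abs_lt hlt]

theorem neg_one_lt_add_div_one_add_mul {a t : ℝ} (ha : |a| < 1) (ht : |t| < 1) :
    -1 < (t + a) / (1 + a * t) := by
  rw [lt_div_iff₀ (one_add_mul_pos ha ht)]
  linarith [mul_pos (neg_lt_iff_pos_add'.mp (neg_lt_of_abs_lt ha))
    (neg_lt_iff_pos_add'.mp (neg_lt_of_abs_lt ht))]

theorem hasDerivAt_diskAut_mul {a t p E : ℝ} (ha : |a| < 1) (ht : |t| < 1)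
    (hval : h t = (t * E : ℝ)) (hder : HasDerivAt h (p * E : ℝ) t) :
    HasDerivAt (fun z => diskAut a z * h z)
      ((((1 - a ^ 2) * t / (1 + a * t) ^ 2 + (t + a) / (1 + a * t) * p) * E : ℝ)) t := by
  refine ((hasDerivAt_diskAut (ofReal_mem_disk.mpr ha) (ofReal_mem_disk.mpr ht)).fun_mul
    hder).congr_deriv ?_
  rw [diskAut_ofReal, hval, ← Complex.conj_mul', Complex.conj_ofReal]
  push_cast
  ring

theorem add_deriv_diskAut_mul_neg {a t p : ℝ} (ha : |a| < 1) (ht : |t| < 1)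
    (hneg : p * (1 + t) * (1 + a * t) + (1 - a) * t < 0) :
    p + ((1 - a ^ 2) * t / (1 + a * t) ^ 2 + (t + a) / (1 + a * t) * p) < 0 := by
  have hpos := one_add_mul_pos ha ht
  have heq : p + ((1 - a ^ 2) * t / (1 + a * t) ^ 2 + (t + a) / (1 + a * t) * p) =
      (1 + a) / (1 + a * t) ^ 2 * (p * (1 + t) * (1 + a * t) + (1 - a) * t) := by
    field_simp
    ring
  rw [heq]
  exact mul_neg_of_pos_of_neg
    (div_pos (by linarith [neg_lt_of_abs_lt ha]) (pow_pos hpos 2)) hneg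

theorem exists_abs_lt_one_add_neg {p t : ℝ} (hgap : (1 - t ^ 2) * p + 2 * t < 0) :
    ∃ a : ℝ, |a| < 1 ∧ p * (1 + t) * (1 + a * t) + (1 - a) * t < 0 := by
  have hcont : Continuous fun a : ℝ => p * (1 + t) * (1 + a * t) + (1 - a) * t := by fun_prop
  -- At `a = -1` the expression is exactly the left side of `hgap`.
  have hev := (hcont.tendsto (-1)).eventually_lt_const (u := 0) (by linarith)
  obtain ⟨a, hneg, ha⟩ := ((hev.filter_mono nhdsWithin_le_nhds).and
    (Ioo_mem_nhdsGT (by norm_num : (-1 : ℝ) < 1))).exists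
  exact ⟨a, abs_lt.mpr ha, hneg⟩

theorem MaMindaStarlike.harmonicClass_add_conj_diskAut_mul {ψ : ℂ → ℂ} {a : ℂ}
    (hh : MaMindaStarlike ψ h) (ha : a ∈ disk 1) :
    HarmonicClass ψ fun z => h z + (starRingEnd ℂ) (diskAut a z * h z) :=
  ⟨h, fun z => diskAut a z * h z, diskAut a, hh, isSelfMap_diskAut ha, fun _ _ => rfl,
    fun _ _ => rfl⟩

theorem not_injOn_add_conj_diskAut_mul {a s x p ρ : ℝ} {E : ℝ → ℝ}
    (hh : DifferentiableOn ℂ h (disk 1)) (ha : |a| < 1) (hs : s ∈ Ioo (-1) 0)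
    (hval : ∀ t ∈ Icc s 0, 0 < E t ∧ h t = (t * E t : ℝ)) (hsx : x ∈ Ioo s 0)
    (hder : HasDerivAt h (p * E x : ℝ) x)
    (hneg : p * (1 + x) * (1 + a * x) + (1 - a) * x < 0) (hsρ : -s < ρ) (hρ : ρ ≤ 1) :
    ¬InjOn (fun z => h z + (starRingEnd ℂ) (diskAut a z * h z)) (disk ρ) := by
  have hdisk : disk ρ ⊆ disk 1 := ball_subset_ball hρ
  have hx : |x| < 1 := abs_lt.mpr ⟨hs.1.trans hsx.1, hsx.2.trans one_pos⟩
  refine not_injOn_add_conj_of_ofReal (a := s) (b := 0) isOpen_ball (hh.mono hdisk)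
    (((isSelfMap_diskAut (ofReal_mem_disk.mpr ha)).analytic.mul hh).mono hdisk)
    (fun t ht => ofReal_mem_disk.mpr
      (abs_lt.mpr ⟨by linarith [ht.1], by linarith [ht.2, hs.2]⟩))
    (fun t ht => ?_) ?_ hsx hder
    (hasDerivAt_diskAut_mul ha hx (hval x (Ioo_subset_Icc_self hsx)).2 hder) ?_
  · rw [diskAut_ofReal, (hval t ht).2, ← Complex.ofReal_mul]
    exact ⟨Complex.ofReal_im _, Complex.ofReal_im _⟩
  · obtain ⟨hE, hhs⟩ := hval s (left_mem_Icc.mpr hs.2.le)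
    have hs1 : |s| < 1 := abs_lt.mpr ⟨hs.1, hs.2.trans one_pos⟩
    have hφ := neg_one_lt_add_div_one_add_mul ha hs1
    have h0 : h (0 : ℝ) = 0 := by
      rw [(hval 0 (right_mem_Icc.mpr hs.2.le)).2, zero_mul, Complex.ofReal_zero]
    rw [diskAut_ofReal, hhs, ← Complex.ofReal_mul, ← Complex.ofReal_add, Complex.ofReal_re, h0,
      mul_zero, add_zero, Complex.zero_re, ← one_add_mul]
    exact mul_nonpos_of_nonneg_of_nonpos (by linarith)
      (mul_nonpos_of_nonpos_of_nonneg hs.2.le hE.le)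
  · rw [← add_mul]
    exact mul_neg_of_neg_of_pos (add_deriv_diskAut_mul_neg ha hx hneg)
      (hval x (Ioo_subset_Icc_self hsx)).1

theorem IsRadiusRoot.exists_harmonicClass_not_injOn {ψ : ℂ → ℂ} {r ρ : ℝ}
    (hr : IsRadiusRoot ψ r) (hψ : DifferentiableOn ℂ ψ (disk 1)) (h0 : ψ 0 = 1)
    (hne : ∀ z ∈ disk 1, ψ z ≠ 0)
    (hm : ∀ x : ℝ, 0 < x → x < 1 → ψ (-(x : ℂ)) = minModulus ψ x) (hrρ : r < ρ) (hρ : ρ ≤ 1) :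
    ∃ f, HarmonicClass ψ f ∧ ¬SensePreservingOn f (disk ρ) ∧ ¬InjOn f (disk ρ) := by
  have hψreal : ∀ t ∈ Ioo (-1 : ℝ) 0, ψ t = minModulus ψ (-t) := fun t ht => by
    simpa only [Complex.ofReal_neg, neg_neg] using
      hm (-t) (neg_pos.mpr ht.2) (neg_lt.mp ht.1)
  obtain ⟨h, hh, E, hE⟩ := exists_maMindaStarlike_ofReal hψ h0 fun t ht => by
    rw [hψreal t ht, Complex.ofReal_im]
  obtain ⟨x, hρx, hxr⟩ := exists_between (neg_lt_neg hrρ)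
  obtain ⟨s, hρs, hsx⟩ := exists_between hρx
  have hx0 : x < 0 := hxr.trans (neg_lt_zero.mpr hr.1)
  have hs1 : -1 < s := (neg_le_neg hρ).trans_lt hρs
  have hx1 : |x| < 1 := abs_lt.mpr ⟨hs1.trans hsx, hx0.trans one_pos⟩
  have hgap := hr.radiusGap_neg hψ hne (lt_neg.mpr hxr) (neg_lt.mp (hs1.trans hsx))
  rw [radiusGap, neg_sq, mul_neg, sub_neg_eq_add] at hgap
  obtain ⟨a, ha, hneg⟩ := exists_abs_lt_one_add_neg hgap
  obtain ⟨hEx, hhx, hder⟩ := hE x ⟨hs1.trans hsx, hx0.le⟩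
  rw [hψreal x ⟨hs1.trans hsx, hx0⟩, ← Complex.ofReal_mul] at hder
  refine ⟨_, hh.harmonicClass_add_conj_diskAut_mul (ofReal_mem_disk.mpr ha), fun hpos => ?_,
    not_injOn_add_conj_diskAut_mul hh.analytic ha ⟨hs1, hsx.trans hx0⟩ (fun t ht => ?_) ⟨hsx, hx0⟩
      hder hneg (neg_lt.mp hρs) hρ⟩
  · have hm0 : 0 ≤ minModulus ψ (-x) :=
      (minModulus_pos hψ.continuousOn hne ⟨neg_nonneg.mpr hx0.le, neg_lt.mp (hs1.trans hsx)⟩).le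
    refine not_jacobian_add_conj_pos hder (hasDerivAt_diskAut_mul ha hx1 hhx hder)
      (mul_nonneg hm0 hEx.le) ?_ (hpos x (ofReal_mem_disk.mpr ?_))
    · rw [← add_mul]
      exact mul_neg_of_neg_of_pos (add_deriv_diskAut_mul_neg ha hx1 hneg) hEx
    · exact abs_lt.mpr ⟨hρx, by linarith [hr.1]⟩
  · obtain ⟨hEt, hht, -⟩ := hE t ⟨hs1.trans_le ht.1, ht.2⟩
    exact ⟨hEt, hht⟩

end Sharpness

theorem IsMaMinda.ne_zero {ψ : ℂ → ℂ} (hψ : IsMaMinda ψ) : ∀ z ∈ disk 1, ψ z ≠ 0 :=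
  fun z hz hzero => (hψ.re_pos z hz).ne' (by rw [hzero, Complex.zero_re])

theorem mainTheorem1_general (ψ : ℂ → ℂ) (hψ : DifferentiableOn ℂ ψ (disk 1)) (h0 : ψ 0 = 1)
    (hne : ∀ z ∈ disk 1, ψ z ≠ 0) :
    (∃! r : ℝ, IsRadiusRoot ψ r) ∧
    ∀ rψ : ℝ, IsRadiusRoot ψ rψ →
      (∀ f : ℂ → ℂ, HarmonicClass ψ f →
        SensePreservingOn f (disk rψ) ∧ InjOn f (disk (min rψ (radiusOfConvexity ψ)))) ∧
      ((∀ r : ℝ, 0 < r → r < 1 → ψ (-(r : ℂ)) = (minModulus ψ r : ℂ)) →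
        ∀ ρ : ℝ, rψ < ρ → ρ ≤ 1 →
          ∃ f : ℂ → ℂ, HarmonicClass ψ f ∧
            ¬SensePreservingOn f (disk ρ) ∧ ¬InjOn f (disk ρ)) :=
  ⟨existsUnique_isRadiusRoot hψ hne, fun _ hr =>
    ⟨fun _ hf => ⟨hf.sensePreservingOn hψ hne hr, hf.injOn hψ hne hr⟩,
      fun hm _ hrρ hρ => hr.exists_harmonicClass_not_injOn hψ h0 hne hm hrρ hρ⟩⟩

theorem mainTheorem1 (ψ : ℂ → ℂ) (hψ : IsMaMinda ψ) :
    (∃! r : ℝ, IsRadiusRoot ψ r) ∧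
    ∀ rψ : ℝ, IsRadiusRoot ψ rψ →
      (∀ f : ℂ → ℂ, HarmonicClass ψ f →
        SensePreservingOn f (disk (min rψ (radiusOfConvexity ψ))) ∧
        InjOn f (disk (min rψ (radiusOfConvexity ψ)))) ∧
      (rψ ≤ radiusOfConvexity ψ →
        (∀ r : ℝ, 0 < r → r < 1 → ψ (-(r : ℂ)) = (minModulus ψ r : ℂ)) →
        ∀ ρ : ℝ, min rψ (radiusOfConvexity ψ) < ρ → ρ ≤ 1 →
          ∃ f : ℂ → ℂ, HarmonicClass ψ f ∧
            ¬ SensePreservingOn f (disk ρ) ∧ ¬ InjOn f (disk ρ)) := by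
  obtain ⟨hroot, h⟩ := mainTheorem1_general ψ hψ.analytic hψ.map_zero hψ.ne_zero
  refine ⟨hroot, fun rψ hr => ⟨fun f hf => ?_, fun hle hm ρ hρ => ?_⟩⟩
  · obtain ⟨hsense, hinj⟩ := (h rψ hr).1 f hf
    exact ⟨fun z hz => hsense z (ball_subset_ball (min_le_left _ _) hz), hinj⟩
  · exact (h rψ hr).2 hm ρ (min_eq_left hle ▸ hρ)
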